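/- Let $\ell$ be a prime, let $\Gamma$ be a profinite group, and let $R$ be an affine group scheme of finite type over $\mathbb Z_\ell$ whose generic fibre $R_{\mathbb Q_\ell}$ is a reductive (not necessarily connected) group. Let $\rho_{\mathbb Z_\ell}\colon\Gamma\to R(\mathbb Z_\ell)$ be a continuous homomorphism such that the induced homomorphism $\rho_{\mathbb Q_\ell}\colon\Gamma\to R(\mathbb Q_\ell)$ has Zariski-dense image. Let $P=\operatorname{im}\rho_{\mathbb Z_\ell}$, a profinite group, and let $\Gamma^{\mathrm{rel}(\ell)}$ be the relative pro-$\ell$ completion of $\Gamma$ with respect to $\Gamma\to P$: a profinite group with a continuous homomorphism $j\colon\Gamma\to\Gamma^{\mathrm{rel}(\ell)}$ with dense image and a continuous surjection $q\colon\Gamma^{\mathrm{rel}(\ell)}\to P$ with pro-$\ell$ kernel such that $q\circ j=\rho_{\mathbb Z_\ell}$, and such that every continuous lift $\varphi\colon\Gamma\to G$ of $\Gamma\to P$ to a profinite group $G$ with a continuous surjection $G\to P$ with pro-$\ell$ kernel is of the form $\varphi=\tilde\varphi\circ j$ for a unique continuous homomorphism $\tilde\varphi\colon\Gamma^{\mathrm{rel}(\ell)}\to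 G$. Let $\rho^{\mathrm{rel}(\ell)}_{\mathbb Q_\ell}\colon\Gamma^{\mathrm{rel}(\ell)}\xrightarrow{q}P\subseteq R(\mathbb Z_\ell)\to R(\mathbb Q_\ell)$ be the induced representation. For a profinite group $\Delta$ and a continuous homomorphism $\rho\colon\Delta\to R(\mathbb Q_\ell)$ with Zariski-dense image, the continuous relative completion of $\Delta$ with respect to $\rho$ is a pro-algebraic $\mathbb Q_\ell$-group $\mathcal G$ (an affine group scheme over $\mathbb Q_\ell$) with a homomorphism $\mathcal G\to R_{\mathbb Q_\ell}$ making it an extension of $R_{\mathbb Q_\ell}$ by a prounipotent group, together with a continuous homomorphism $\tilde\rho\colon\Delta\to\mathcal G(\mathbb Q_\ell)$ with Zariski-dense image lifting $\rho$, such that for every extension $G\to R_{\mathbb Q_\ell}$ of pro-algebraic groups with prounipotent kernel and every continuous $\psi\colon\Delta\to G(\mathbb Q_\ell)$ lifting $\rho$ there is a unique morphism $\phi\colon\mathcal G\to G$ over $R_{\mathbb Q_\ell}$ with $\phi\circ\tilde\rho=\psi$. Then the continuous relative completion of $\Gamma^{\mathrm{rel}(\ell)}$ with respect to $\rho^{\mathrm{rel}(\ell)}_{\mathbb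 Q_\ell}$ is canonically isomorphic to the continuous relative completion of $\Gamma$ with respect to $\rho_{\mathbb Q_\ell}$. Precisely, if $(\mathcal G,\tilde\rho)$ and $(\mathcal G^{\mathrm{rel}(\ell)},\tilde\rho^{\mathrm{rel}(\ell)})$ denote continuous relative completions of $\Gamma$ and of $\Gamma^{\mathrm{rel}(\ell)}$ with respect to these representations, then there is a unique isomorphism $\phi\colon\mathcal G\to\mathcal G^{\mathrm{rel}(\ell)}$ of $\mathbb Q_\ell$-groups over $R_{\mathbb Q_\ell}$ such that $\phi\circ\tilde\rho=\tilde\rho^{\mathrm{rel}(\ell)}\circ j$. -/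

import Mathlib

open scoped TensorProduct

universe u v w t

namespace RelativeCompletion

/-! ### Affine group schemes

An affine group scheme `G` over a commutative ring `k` is represented by its coordinate ring
`A = O(G)`, a commutative Hopf algebra over `k`. A homomorphism `G → H` is a bialgebra
homomorphism `O(H) →ₐc[k] O(G)`. Pro-algebraic groups over a field are the affine group schemes
over it. -/

/-- The group `G(k)` of `k`-points, `A = O(G)`, under Mathlib's convolution product
`(p * q) a = ∑ p a₁ * q a₂`. -/
abbrev Points (k : Type u) (A : Type v) [CommRing k] [CommRing A] [HopfAlgebra k A] :
    Type (max u v) :=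
  WithConv (A →ₐ[k] k)

section Topology

variable {k : Type u} {A : Type v} [CommRing k] [CommRing A] [HopfAlgebra k A]

/-- The topology of `G(k)` for a topological ring `k`: the coarsest one for which all regular
functions `a ∈ O(G)` are continuous. For `G` of finite type it is the topology of `G(k)` as a
closed subset of `kⁿ`; in general it is the inverse limit topology. -/
instance Points.topologicalSpace [TopologicalSpace k] : TopologicalSpace (Points k A) :=
  TopologicalSpace.induced (fun p a => p.ofConv a) inferInstance

theorem Points.continuous_eval [TopologicalSpace k] (a : A) :
    Continuous (fun p : Points k A => p.ofConv a) :=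
  (continuous_apply a).comp continuous_induced_dom

theorem Points.continuous_iff [TopologicalSpace k] {X : Type w} [TopologicalSpace X]
    {f : X → Points k A} : Continuous f ↔ ∀ a : A, Continuous (fun x => (f x).ofConv a) := by
  rw [continuous_induced_rng, continuous_pi_iff]
  rfl

instance Points.isTopologicalGroup [TopologicalSpace k] [IsTopologicalRing k] :
    IsTopologicalGroup (Points k A) where
  continuous_mul := by
    rw [Points.continuous_iff]
    intro a
    simp only [AlgHom.convMul_apply]
    generalize (CoalgebraStruct.comul a : A ⊗[k] A) = t
    induction t with
    | zero => simpa using continuous_const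
    | tmul x y =>
      simp only [Algebra.TensorProduct.lift_tmul]
      exact ((Points.continuous_eval x).comp continuous_fst).mul
        ((Points.continuous_eval y).comp continuous_snd)
    | add x y hx hy =>
      simp only [map_add]
      exact hx.add hy
  continuous_inv := by
    rw [Points.continuous_iff]
    intro a
    exact Points.continuous_eval (HopfAlgebra.antipodeAlgHom k A a)

instance Points.totallyDisconnectedSpace [TopologicalSpace k] [TotallyDisconnectedSpace k] :
    TotallyDisconnectedSpace (Points k A) := by
  have hc : Continuous (fun (p : Points k A) (a : A) => p.ofConv a) := continuous_induced_dom
  have hi : Function.Injective (fun (p : Points k A) (a : A) => p.ofConv a) := by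
    intro p q h
    exact WithConv.ext (AlgHom.ext (fun a => congrFun h a))
  exact ⟨isTotallyDisconnected_of_image hc.continuousOn hi
    (isTotallyDisconnected_of_totallyDisconnectedSpace _)⟩

/-- The homomorphism `G(k) → H(k)` induced by a homomorphism `G → H`, given as
`f : O(H) → O(G)`. -/
def Points.map [TopologicalSpace k] {A' : Type w} [CommRing A'] [HopfAlgebra k A']
    (f : A' →ₐc[k] A) : Points k A →ₜ* Points k A' where
  toFun p := WithConv.toConv (p.ofConv.comp (f : A' →ₐ[k] A))
  map_one' := by
    apply WithConv.ext
    apply AlgHom.ext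
    intro a
    change (1 : Points k A).ofConv (f a) = (1 : Points k A').ofConv a
    simp
  map_mul' p q := by
    apply WithConv.ext
    exact AlgHom.convMul_comp_bialgHom_distrib p q f
  continuous_toFun := by
    rw [Points.continuous_iff]
    intro a
    exact Points.continuous_eval (f a)

/-- A set of `k`-points of `G`, with `k` a field, is Zariski dense if the corresponding set of
(closed) points of the scheme `G = Spec A` is dense. -/
def IsZariskiDense {k : Type u} {A : Type v} [Field k] [CommRing A] [HopfAlgebra k A]
    (S : Set (Points k A)) : Prop :=
  Dense ((fun p : Points k A => (⟨RingHom.ker p.ofConv, RingHom.ker_isPrime _⟩ :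
    PrimeSpectrum A)) '' S)

end Topology

/-! ### Unipotent and reductive groups -/

section Unipotent

/-- `g` is a homomorphism from the group with coordinate ring `C` to the group of upper
unitriangular `n × n` matrices, given by its matrix of coordinate functions. -/
structure IsUnitriangularRep (k : Type u) {C : Type v} [Field k] [CommRing C] [HopfAlgebra k C]
    {n : ℕ} (g : Matrix (Fin n) (Fin n) C) : Prop where
  comul : ∀ i j, CoalgebraStruct.comul (R := k) (g i j) = ∑ m, g i m ⊗ₜ[k] g m j
  counit : ∀ i j, CoalgebraStruct.counit (R := k) (g i j) = if i = j then 1 else 0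
  diag : ∀ i, g i i = 1
  lower : ∀ i j, j < i → g i j = 0

/-- A prounipotent group: an inverse limit of unipotent algebraic groups, that is, of closed
subgroups of unitriangular groups. On coordinate rings: `C` is the directed union of the
subalgebras generated by the matrix entries of homomorphisms to unitriangular groups. For `C` of
finite type this says that the group is isomorphic to a closed subgroup of a unitriangular
group. -/
def IsProunipotent (k : Type u) (C : Type v) [Field k] [CommRing C] [HopfAlgebra k C] : Prop :=
  ∀ S : Finset C, ∃ (n : ℕ) (g : Matrix (Fin n) (Fin n) C), IsUnitriangularRep k g ∧
    (S : Set C) ⊆ Algebra.adjoin k (Set.range fun ij : Fin n × Fin n => g ij.1 ij.2)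

/-- The closed subgroup `N` of `G` given by the surjection `p : O(G) → O(N)` is normal: `N(T)` is
a normal subgroup of `G(T)` for all `k`-algebras `T`. -/
def IsNormalSubgroup {k : Type u} {A C : Type v} [Field k] [CommRing A] [HopfAlgebra k A]
    [CommRing C] [HopfAlgebra k C] (p : A →ₐc[k] C) : Prop :=
  ∀ (T : Type v) [CommRing T] [Algebra k T] (x : WithConv (A →ₐ[k] T))
    (y : WithConv (C →ₐ[k] T)), ∃ z : WithConv (C →ₐ[k] T),
      x * WithConv.toConv (y.ofConv.comp (p : A →ₐ[k] C)) =
        WithConv.toConv (z.ofConv.comp (p : A →ₐ[k] C)) * x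

/-- The group with coordinate ring `A` over a field `k` of characteristic zero is a reductive
(not necessarily connected) algebraic group: it is of finite type, and over an algebraic closure
of `k` every normal unipotent closed subgroup is trivial. (In characteristic zero unipotent
groups are automatically smooth and connected.) -/
def IsReductive (k : Type u) (A : Type v) [Field k] [CharZero k] [CommRing A]
    [HopfAlgebra k A] : Prop :=
  Algebra.FiniteType k A ∧
    ∀ (C : Type (max u v)) [CommRing C] [HopfAlgebra (AlgebraicClosure k) C]
      (p : AlgebraicClosure k ⊗[k] A →ₐc[AlgebraicClosure k] C),
      Function.Surjective p → IsNormalSubgroup p → IsProunipotent (AlgebraicClosure k) C →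
        Function.Bijective (algebraMap (AlgebraicClosure k) C)

/-- The homomorphism `π : G → R` given by `f : O(R) → O(G)` makes `G` an extension of `R` by a
prounipotent group: `1 → U → G → R → 1` is exact with `U` prounipotent. Over a field, `π` is a
quotient map if and only if `f` is injective, and `ker π` is the closed subgroup of `G` cut out by
the ideal generated by the image of the augmentation ideal of `O(R)`. -/
structure IsProunipotentExtension {k : Type u} {O : Type w} {A : Type v} [Field k]
    [CommRing O] [HopfAlgebra k O] [CommRing A] [HopfAlgebra k A] (f : O →ₐc[k] A) : Prop where
  injective : Function.Injective f
  kernel : ∃ (U : Type v) (_ : CommRing U) (_ : HopfAlgebra k U) (i : A →ₐc[k] U),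
    Function.Surjective i ∧
    RingHom.ker i = Ideal.map f (RingHom.ker (Bialgebra.counitAlgHom k O)) ∧
    IsProunipotent k U

end Unipotent

/-! ### Continuous relative completion -/

/-- `G` (with `A = O(G)`), its homomorphism to `R` (given by `f : O(R) → O(G)`), and
`σ : Γ → G(k)` form the continuous relative completion of the topological group `Γ` with respect
to the continuous representation `ρ : Γ → R(k)`. -/
structure IsContinuousRelativeCompletion {k : Type t} {O : Type w} {Γ : Type u} {A : Type v}
    [Field k] [TopologicalSpace k] [Group Γ] [TopologicalSpace Γ]
    [CommRing O] [HopfAlgebra k O] [CommRing A] [HopfAlgebra k A]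
    (ρ : Γ →ₜ* Points k O) (f : O →ₐc[k] A) (σ : Γ →ₜ* Points k A) : Prop where
  extension : IsProunipotentExtension f
  dense : IsZariskiDense (Set.range σ)
  lift : (Points.map f).comp σ = ρ
  universal : ∀ (A' : Type v) [CommRing A'] [HopfAlgebra k A'] (f' : O →ₐc[k] A')
    (ψ : Γ →ₜ* Points k A'), IsProunipotentExtension f' → (Points.map f').comp ψ = ρ →
      ∃! φ : A' →ₐc[k] A, φ.comp f' = f ∧ (Points.map φ).comp σ = ψ

/-! ### Relative pro-`ℓ` completion -/

/-- A compact group `K` is pro-`ℓ`: its open normal subgroups have `ℓ`-power index. -/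
def IsProL (ℓ : ℕ) (K : Type u) [Group K] [TopologicalSpace K] : Prop :=
  ∀ N : Subgroup K, N.Normal → IsOpen (N : Set K) → ∃ m : ℕ, N.index = ℓ ^ m

/-- The profinite group `E` with `j : Γ → E` and `q : E → P` is the relative pro-`ℓ` completion of
the profinite group `Γ` with respect to the continuous homomorphism `ρ : Γ → P` with dense image
in the profinite group `P`. -/
structure IsRelativeProLCompletion (ℓ : ℕ) {Γ : ProfiniteGrp.{u}} {P : ProfiniteGrp.{w}}
    {E : ProfiniteGrp.{u}} (ρ : Γ →ₜ* P) (j : Γ →ₜ* E) (q : E →ₜ* P) : Prop where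
  surjective : Function.Surjective q
  kernel : IsProL ℓ q.toMonoidHom.ker
  lift : q.comp j = ρ
  dense : DenseRange j
  universal : ∀ (G : ProfiniteGrp.{u}) (p : G →ₜ* P) (φ : Γ →ₜ* G),
    Function.Surjective p → IsProL ℓ p.toMonoidHom.ker → p.comp φ = ρ →
      ∃! φ' : E →ₜ* G, φ'.comp j = φ

/-- The image of a continuous homomorphism from a profinite group to a totally disconnected
group, as a profinite group. -/
def image {Γ : ProfiniteGrp.{u}} {H : Type w} [Group H] [TopologicalSpace H]
    [IsTopologicalGroup H] [TotallyDisconnectedSpace H] (ρ : Γ →ₜ* H) : ProfiniteGrp.{w} :=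
  haveI : CompactSpace ρ.toMonoidHom.range :=
    isCompact_iff_compactSpace.mp (isCompact_range ρ.continuous_toFun)
  ProfiniteGrp.of ρ.toMonoidHom.range

/-- The homomorphism of `Γ` onto the image of `ρ`. -/
def toImage {Γ : ProfiniteGrp.{u}} {H : Type w} [Group H] [TopologicalSpace H]
    [IsTopologicalGroup H] [TotallyDisconnectedSpace H] (ρ : Γ →ₜ* H) : Γ →ₜ* image ρ where
  toMonoidHom := ρ.toMonoidHom.rangeRestrict
  continuous_toFun := ρ.continuous_toFun.subtype_mk _

/-- The inclusion of the image of `ρ`. -/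
def imageInclusion {Γ : ProfiniteGrp.{u}} {H : Type w} [Group H] [TopologicalSpace H]
    [IsTopologicalGroup H] [TotallyDisconnectedSpace H] (ρ : Γ →ₜ* H) : image ρ →ₜ* H where
  toMonoidHom := ρ.toMonoidHom.range.subtype
  continuous_toFun := continuous_subtype_val

/-! ### Integral models -/

/-- The coordinate ring of the generic fibre of the affine group scheme over `ℤ_ℓ` with coordinate
ring `B`. -/
abbrev GenericFibre (ℓ : ℕ) [Fact ℓ.Prime] (B : Type v) [CommRing B] [HopfAlgebra ℤ_[ℓ] B] :
    Type v :=
  ℚ_[ℓ] ⊗[ℤ_[ℓ]] B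

/-- The inclusion `R(ℤ_ℓ) → R(ℚ_ℓ)`. -/
noncomputable def integralPoints (ℓ : ℕ) [Fact ℓ.Prime] (B : Type v) [CommRing B]
    [HopfAlgebra ℤ_[ℓ] B] : Points ℤ_[ℓ] B →ₜ* Points ℚ_[ℓ] (GenericFibre ℓ B) where
  toFun p := WithConv.toConv (Algebra.TensorProduct.lift (AlgHom.id ℚ_[ℓ] ℚ_[ℓ])
    ((Algebra.ofId ℤ_[ℓ] ℚ_[ℓ]).comp p.ofConv) (fun _ _ => Commute.all _ _))
  map_one' := by
    apply WithConv.ext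
    apply Algebra.TensorProduct.ext'
    intro x b
    simp [Algebra.smul_def, Algebra.ofId_apply, mul_comm]
  map_mul' p q := by
    apply WithConv.ext
    apply Algebra.TensorProduct.ext'
    intro x b
    simp only [AlgHom.convMul_apply, TensorProduct.comul_tmul, Algebra.TensorProduct.lift_tmul,
      AlgHom.coe_id, id_eq, AlgHom.coe_comp, Function.comp_apply, CommSemiring.comul_apply]
    generalize (CoalgebraStruct.comul b : B ⊗[ℤ_[ℓ]] B) = s
    induction s with
    | zero => simp
    | tmul y z => simp [Algebra.ofId_apply, mul_left_comm]
    | add y z hy hz => simp only [TensorProduct.tmul_add, map_add, mul_add, hy, hz]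
  continuous_toFun := by
    rw [Points.continuous_iff]
    intro a
    induction a using TensorProduct.induction_on with
    | zero => simpa using continuous_const
    | tmul x b =>
      exact continuous_const.mul
        (continuous_subtype_val.comp (Points.continuous_eval (k := ℤ_[ℓ]) b))
    | add x y hx hy =>
      simp only [map_add]
      exact hx.add hy

end RelativeCompletion

open Filter Topology

namespace RelativeCompletion

/-! Every `ℚ_[ℓ]`-point `u` of a prounipotent group satisfies `u ^ ℓ ^ m → 1`, so its compact
subgroups are pro-`ℓ` (`IsProL.of_tendsto_pow`). Let `ψ` lift `Γ → P` to the points of a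
prounipotent extension of `R`. The image of `ψ` is profinite, surjects onto `P`, and the kernel of
that surjection is a compact group of prounipotent points, hence pro-`ℓ`. So `ψ` factors through the
relative pro-`ℓ` completion (`exists_extension`). Lifts from `Γ` and from its relative pro-`ℓ`
completion therefore correspond, and the two universal properties yield mutually inverse morphisms
(`existsUnique_bialgEquiv`). -/

/-! ### Powers of unitriangular `ℓ`-adic matrices. -/

/-- From `k * choose (ℓ^m) k = ℓ^m * choose (ℓ^m - 1) (k - 1)`, the norm is at most `‖ℓ‖^m / ‖k‖`.
-/
theorem tendsto_choose_prime_pow (ℓ : ℕ) [Fact ℓ.Prime] {k : ℕ} (hk : k ≠ 0) :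
    Tendsto (fun m : ℕ => (((ℓ ^ m).choose k : ℕ) : ℚ_[ℓ])) atTop (𝓝 0) := by
  obtain ⟨k, rfl⟩ := Nat.exists_eq_succ_of_ne_zero hk
  have hk0 : ((k + 1 : ℕ) : ℚ_[ℓ]) ≠ 0 := Nat.cast_ne_zero.mpr k.succ_ne_zero
  have hℓ : Tendsto (fun m : ℕ => ‖(ℓ : ℚ_[ℓ])‖ ^ m * ‖((k + 1 : ℕ) : ℚ_[ℓ])‖⁻¹) atTop (𝓝 0) := by
    simpa using (tendsto_pow_atTop_nhds_zero_of_lt_one (norm_nonneg _)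
      (Padic.norm_p_lt_one (p := ℓ))).mul_const (‖((k + 1 : ℕ) : ℚ_[ℓ])‖⁻¹)
  refine squeeze_zero_norm (fun m => ?_) hℓ
  have hpos : 0 < ℓ ^ m := pow_pos (Fact.out (p := ℓ.Prime)).pos m
  have h := Nat.add_one_mul_choose_eq (ℓ ^ m - 1) k
  rw [Nat.sub_add_cancel hpos] at h
  have h' : (((ℓ ^ m).choose (k + 1) : ℕ) : ℚ_[ℓ]) =
      (ℓ : ℚ_[ℓ]) ^ m * (((ℓ ^ m - 1).choose k : ℕ) : ℚ_[ℓ]) * ((k + 1 : ℕ) : ℚ_[ℓ])⁻¹ := by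
    rw [eq_mul_inv_iff_mul_eq₀ hk0]
    exact_mod_cast h.symm
  have hint : ‖(((ℓ ^ m - 1).choose k : ℕ) : ℚ_[ℓ])‖ ≤ 1 := by
    exact_mod_cast Padic.norm_int_le_one (p := ℓ) ((ℓ ^ m - 1).choose k : ℤ)
  rw [Nat.succ_eq_add_one, h', norm_mul, norm_mul, norm_pow, norm_inv]
  refine mul_le_mul_of_nonneg_right ?_ (inv_nonneg.mpr (norm_nonneg _))
  exact mul_le_of_le_one_right (by positivity) hint

theorem one_add_pow_eq_sum_of_pow_eq_zero {S : Type*} [Semiring S] {x : S} {d : ℕ}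
    (hx : x ^ d = 0) (n : ℕ) :
    (1 + x) ^ n = ∑ k ∈ Finset.range d, x ^ k * (n.choose k : S) := by
  rw [add_comm, (Commute.one_right x).add_pow]
  simp only [one_pow, mul_one]
  trans ∑ k ∈ Finset.range (max (n + 1) d), x ^ k * (n.choose k : S)
  · refine Finset.sum_subset (Finset.range_mono (le_max_left _ _)) fun k _ hk => ?_
    rw [Nat.choose_eq_zero_of_lt (by simpa using hk), Nat.cast_zero, mul_zero]
  · refine (Finset.sum_subset (Finset.range_mono (le_max_right _ _)) fun k _ hk => ?_).symm
    rw [pow_eq_zero_of_le (by simpa using hk) hx, zero_mul]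

/-- `N = M - 1` is nilpotent by Cayley–Hamilton, so the binomial expansion has a fixed number of
terms, and only the term `k = 0` survives in the limit. -/
theorem tendsto_unitriangular_pow (ℓ : ℕ) [Fact ℓ.Prime] {n : ℕ}
    (M : Matrix (Fin n) (Fin n) ℚ_[ℓ]) (diag : ∀ i, M i i = 1) (lower : ∀ i j, j < i → M i j = 0) :
    Tendsto (fun m : ℕ => M ^ ℓ ^ m) atTop (𝓝 1) := by
  set N := M - 1 with hN
  have hnil : N ^ n = 0 := by
    have htri : N.IsUpperTriangular := by
      intro i j hij
      have hij' : j < i := hij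
      simp [hN, lower i j hij', Matrix.one_apply_ne hij'.ne']
    have h := Matrix.aeval_self_charpoly N
    rw [Matrix.charpoly_of_isUpperTriangular N htri] at h
    simpa [hN, diag] using h
  have hM : M = 1 + N := by simp [hN]
  rw [hM]
  simp only [one_add_pow_eq_sum_of_pow_eq_zero hnil]
  have hlim : ∀ k ∈ Finset.range n, Tendsto (fun m : ℕ =>
      N ^ k * (((ℓ ^ m).choose k : ℕ) : Matrix (Fin n) (Fin n) ℚ_[ℓ])) atTop
      (𝓝 (if k = 0 then 1 else 0)) := by
    intro k _
    rcases eq_or_ne k 0 with rfl | hk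
    · simp
    · rw [if_neg hk]
      have h := (tendsto_choose_prime_pow ℓ hk).smul_const (N ^ k)
      rw [zero_smul] at h
      refine h.congr fun m => ?_
      rw [Nat.cast_smul_eq_nsmul, nsmul_eq_mul, Nat.cast_comm]
  have h := tendsto_finsetSum _ hlim
  -- For `n = 0` the sum is empty and its limit is `0`, which equals `1` among empty matrices.
  rcases n.eq_zero_or_pos with rfl | hn
  · convert h using 1
    exact congrArg _ (Subsingleton.elim _ _)
  · simpa [hn] using h

/-! ### Points of prounipotent groups and extensions. -/

section Points

variable {k : Type u} {A : Type v} [CommRing k] [CommRing A] [HopfAlgebra k A]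

theorem Points.one_ofConv_apply (a : A) :
    (1 : Points k A).ofConv a = CoalgebraStruct.counit (R := k) a := by
  change (1 : Points k A) a = _
  rw [AlgHom.convOne_apply]
  rfl

@[simp]
theorem Points.map_ofConv_apply [TopologicalSpace k] {A' : Type w} [CommRing A']
    [HopfAlgebra k A'] (f : A' →ₐc[k] A) (p : Points k A) (a : A') :
    (Points.map f p).ofConv a = p.ofConv (f a) :=
  rfl

theorem Points.ext_apply {p q : Points k A} (h : ∀ a, p.ofConv a = q.ofConv a) : p = q :=
  WithConv.ext (AlgHom.ext h)

theorem Points.tendsto_iff [TopologicalSpace k] {X : Type*} {F : Filter X} {g : X → Points k A}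
    {p : Points k A} :
    Tendsto g F (𝓝 p) ↔ ∀ a, Tendsto (fun x => (g x).ofConv a) F (𝓝 (p.ofConv a)) := by
  have hind : IsInducing (fun (p : Points k A) (a : A) => p.ofConv a) := ⟨rfl⟩
  rw [hind.tendsto_nhds_iff, tendsto_pi_nhds]
  rfl

end Points

theorem IsUnitriangularRep.map_mul {k : Type u} {C : Type v} [Field k] [CommRing C]
    [HopfAlgebra k C] {n : ℕ} {g : Matrix (Fin n) (Fin n) C} (hg : IsUnitriangularRep k g)
    (p q : Points k C) : g.map (p * q).ofConv = g.map p.ofConv * g.map q.ofConv := by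
  ext i j
  have h : (p * q) (g i j) = ∑ m, p.ofConv (g i m) * q.ofConv (g m j) := by
    rw [AlgHom.convMul_apply, hg.comul, map_sum]
    rfl
  simpa [Matrix.mul_apply] using h

theorem IsUnitriangularRep.map_pow {k : Type u} {C : Type v} [Field k] [CommRing C]
    [HopfAlgebra k C] {n : ℕ} {g : Matrix (Fin n) (Fin n) C} (hg : IsUnitriangularRep k g)
    (p : Points k C) (m : ℕ) : g.map (p ^ m).ofConv = g.map p.ofConv ^ m := by
  induction m with
  | zero =>
    ext i j
    simp only [pow_zero, Matrix.map_apply]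
    rw [Points.one_ofConv_apply, hg.counit, Matrix.one_apply]
  | succ m ih => rw [pow_succ, hg.map_mul, ih, pow_succ]

/-- Convergence is tested on one regular function at a time, and each is a polynomial in the entries
of a single unitriangular representation. -/
theorem IsProunipotent.tendsto_pow_prime_pow {ℓ : ℕ} [Fact ℓ.Prime] {C : Type v} [CommRing C]
    [HopfAlgebra ℚ_[ℓ] C] (hC : IsProunipotent ℚ_[ℓ] C) (p : Points ℚ_[ℓ] C) :
    Tendsto (fun m : ℕ => p ^ ℓ ^ m) atTop (𝓝 1) := by
  rw [Points.tendsto_iff]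
  intro a
  obtain ⟨n, g, hg, hS⟩ := hC {a}
  have hM := tendsto_unitriangular_pow ℓ (g.map p.ofConv) (fun i => by simp [hg.diag])
    (fun i j hij => by simp [hg.lower i j hij])
  have ha := hS (Finset.mem_coe.mpr (Finset.mem_singleton_self a))
  clear hS
  induction ha using Algebra.adjoin_induction with
  | mem x hx =>
    obtain ⟨⟨i, j⟩, rfl⟩ := hx
    have h := tendsto_pi_nhds.mp (tendsto_pi_nhds.mp hM i) j
    have h1 : (1 : Matrix (Fin n) (Fin n) ℚ_[ℓ]) i j = (1 : Points ℚ_[ℓ] C).ofConv (g i j) := by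
      rw [Points.one_ofConv_apply, hg.counit, Matrix.one_apply]
    rw [h1] at h
    refine h.congr fun m => ?_
    rw [← hg.map_pow, Matrix.map_apply]
  | algebraMap r => simp only [AlgHom.commutes]; exact tendsto_const_nhds
  | add x y _ _ hx hy => simp only [map_add]; exact hx.add hy
  | mul x y _ _ hx hy => simp only [_root_.map_mul]; exact hx.mul hy

/-- A point over `1` kills the ideal generated by the augmentation ideal of `O`, so it comes from a
point of the prounipotent kernel. -/
theorem IsProunipotentExtension.tendsto_pow_prime_pow {ℓ : ℕ} [Fact ℓ.Prime] {O : Type w}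
    {A : Type v} [CommRing O] [HopfAlgebra ℚ_[ℓ] O] [CommRing A] [HopfAlgebra ℚ_[ℓ] A]
    {f : O →ₐc[ℚ_[ℓ]] A} (hf : IsProunipotentExtension f) (p : Points ℚ_[ℓ] A)
    (hp : Points.map f p = 1) : Tendsto (fun m : ℕ => p ^ ℓ ^ m) atTop (𝓝 1) := by
  obtain ⟨U, _, _, i, hi, hker, hU⟩ := hf.kernel
  have hle : RingHom.ker i ≤ RingHom.ker p.ofConv := by
    rw [hker, Ideal.map_le_iff_le_comap]
    intro a ha
    have h := congrArg (fun r : Points ℚ_[ℓ] O => r.ofConv a) hp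
    simp only [Points.map_ofConv_apply, Points.one_ofConv_apply] at h
    rw [Ideal.mem_comap, RingHom.mem_ker, h]
    exact ha
  have hlift : ∃ r : Points ℚ_[ℓ] U, Points.map i r = p := by
    refine ⟨WithConv.toConv (AlgHom.liftOfSurjective (i : A →ₐ[ℚ_[ℓ]] U) hi p.ofConv hle), ?_⟩
    apply WithConv.ext
    exact AlgHom.liftOfSurjective_comp (i : A →ₐ[ℚ_[ℓ]] U) hi p.ofConv hle
  obtain ⟨r, rfl⟩ := hlift
  have h := ((Points.map i).continuous_toFun.tendsto 1).comp (hU.tendsto_pow_prime_pow r)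
  have h1 : (Points.map i).toFun 1 = 1 := map_one (Points.map i)
  rw [h1] at h
  exact h.congr fun m => _root_.map_pow (Points.map i) r _

/-! ### Pro-`ℓ` kernels and comparison of the universal properties. -/

/-- An open subgroup eventually contains `x ^ ℓ ^ m`, so every finite quotient by an open normal
subgroup is an `ℓ`-group. -/
theorem IsProL.of_tendsto_pow {ℓ : ℕ} [Fact ℓ.Prime] {K : Type u} [Group K] [TopologicalSpace K]
    [IsTopologicalGroup K] [CompactSpace K]
    (h : ∀ x : K, Tendsto (fun m : ℕ => x ^ ℓ ^ m) atTop (𝓝 1)) : IsProL ℓ K := by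
  intro N hN hopen
  have : Finite (K ⧸ N) := N.quotient_finite_of_isOpen hopen
  have hp : IsPGroup ℓ (K ⧸ N) := by
    intro y
    obtain ⟨x, rfl⟩ := QuotientGroup.mk_surjective y
    obtain ⟨m, hm⟩ := ((h x).eventually (hopen.mem_nhds N.one_mem)).exists
    exact ⟨m, by rw [← QuotientGroup.mk_pow]; exact (QuotientGroup.eq_one_iff _).mpr hm⟩
  exact IsPGroup.iff_card.mp hp

/-- A lift of `Γ → P ⊆ R(ℚ_ℓ)` to a prounipotent extension of `R` factors through the relative
pro-`ℓ` completion of `Γ`. -/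
theorem IsRelativeProLCompletion.exists_extension {ℓ : ℕ} [Fact ℓ.Prime]
    {Γ : ProfiniteGrp.{u}} {P : ProfiniteGrp.{w}} {E : ProfiniteGrp.{u}} {π : Γ →ₜ* P}
    {j : Γ →ₜ* E} {q : E →ₜ* P} (hE : IsRelativeProLCompletion ℓ π j q)
    (hπ : Function.Surjective π) {O : Type t} [CommRing O] [HopfAlgebra ℚ_[ℓ] O]
    {ι : P →ₜ* Points ℚ_[ℓ] O} (hι : Function.Injective ι)
    {A : Type v} [CommRing A] [HopfAlgebra ℚ_[ℓ] A] {f : O →ₐc[ℚ_[ℓ]] A}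
    (hf : IsProunipotentExtension f) (ψ : Γ →ₜ* Points ℚ_[ℓ] A)
    (hψ : (Points.map f).comp ψ = ι.comp π) :
    ∃ ψ' : E →ₜ* Points ℚ_[ℓ] A, ψ'.comp j = ψ ∧ (Points.map f).comp ψ' = ι.comp q := by
  have hψ_apply : ∀ x, Points.map f (ψ x) = ι (π x) := fun x => DFunLike.congr_fun hψ x
  -- `Γ ⧸ N` stands in for the image of `ψ`; it lives in the universe of `Γ`, as `hE.universal`
  -- requires.
  let N := ψ.toMonoidHom.ker
  have hNπ : N ≤ π.toMonoidHom.ker := by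
    intro x hx
    have hx' : ψ x = 1 := hx
    apply hι
    change ι (π x) = ι 1
    rw [← hψ_apply, hx', map_one, map_one]
  let ψbar : Γ ⧸ N →ₜ* Points ℚ_[ℓ] A :=
    { toMonoidHom := QuotientGroup.kerLift ψ.toMonoidHom
      continuous_toFun := ψ.continuous_toFun.quotient_lift _ }
  have hψbar : Function.Injective ψbar := QuotientGroup.kerLift_injective ψ.toMonoidHom
  have : TotallyDisconnectedSpace (Γ ⧸ N) :=
    ⟨isTotallyDisconnected_of_image ψbar.continuous_toFun.continuousOn hψbar
      (isTotallyDisconnected_of_totallyDisconnectedSpace _)⟩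
  let G : ProfiniteGrp.{u} := ProfiniteGrp.of (Γ ⧸ N)
  let p : G →ₜ* P :=
    { toMonoidHom := QuotientGroup.lift N π.toMonoidHom hNπ
      continuous_toFun := π.continuous_toFun.quotient_lift _ }
  let φ : Γ →ₜ* G :=
    { toMonoidHom := QuotientGroup.mk' N
      continuous_toFun := continuous_quotient_mk' }
  have hp : Function.Surjective p := by
    intro y
    obtain ⟨x, rfl⟩ := hπ y
    exact ⟨φ x, rfl⟩
  have hψp : ∀ x : G, Points.map f (ψbar x) = ι (p x) := by
    intro x
    obtain ⟨x, rfl⟩ := QuotientGroup.mk_surjective x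
    exact hψ_apply x
  have hclosed : IsClosed (p.toMonoidHom.ker : Set G) :=
    isClosed_singleton.preimage p.continuous_toFun
  have : CompactSpace p.toMonoidHom.ker := isCompact_iff_compactSpace.mp hclosed.isCompact
  -- A continuous injection from a compact to a Hausdorff space is an embedding, so limits in the
  -- kernel of `p` can be computed among the points.
  have hemb : IsClosedEmbedding ψbar :=
    ψbar.continuous_toFun.isClosedEmbedding hψbar
  have hker : IsProL ℓ p.toMonoidHom.ker := by
    apply IsProL.of_tendsto_pow
    intro x
    rw [(hemb.isInducing.comp IsInducing.subtypeVal).tendsto_nhds_iff]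
    have hx : Points.map f (ψbar x.1) = 1 := by
      have hx' : p x.1 = 1 := x.2
      rw [hψp, hx', map_one]
    have h := hf.tendsto_pow_prime_pow _ hx
    rw [← map_one ψbar] at h
    exact h.congr fun m => (_root_.map_pow ψbar x.1 _).symm
  obtain ⟨φ', hφ', -⟩ := hE.universal G p φ hp hker rfl
  have hext : (ψbar.comp φ').comp j = ψ := by
    ext1 x
    change ψbar (φ' (j x)) = ψ x
    rw [show φ' (j x) = φ x from DFunLike.congr_fun hφ' x]
    rfl
  refine ⟨ψbar.comp φ', hext, ?_⟩
  -- The two maps are compared on the dense image of `j`.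
  apply DFunLike.coe_injective
  refine hE.dense.equalizer ((Points.map f).comp (ψbar.comp φ')).continuous_toFun
    (ι.comp q).continuous_toFun (funext fun x => ?_)
  change Points.map f (ψbar (φ' (j x))) = ι (q (j x))
  rw [show ψbar (φ' (j x)) = ψ x from DFunLike.congr_fun hext x,
    show q (j x) = π x from DFunLike.congr_fun hE.lift x, hψ_apply]

/-- The continuous relative completions of `Γ` and of its relative pro-`ℓ` completion are uniquely
isomorphic. -/
theorem IsRelativeProLCompletion.existsUnique_bialgEquiv {ℓ : ℕ} [Fact ℓ.Prime]
    {Γ : ProfiniteGrp.{u}} {P : ProfiniteGrp.{w}} {E : ProfiniteGrp.{u}} {π : Γ →ₜ* P}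
    {j : Γ →ₜ* E} {q : E →ₜ* P} (hE : IsRelativeProLCompletion ℓ π j q)
    (hπ : Function.Surjective π) {O : Type t} [CommRing O] [HopfAlgebra ℚ_[ℓ] O]
    {ι : P →ₜ* Points ℚ_[ℓ] O} (hι : Function.Injective ι)
    {A : Type v} [CommRing A] [HopfAlgebra ℚ_[ℓ] A] {f : O →ₐc[ℚ_[ℓ]] A}
    {σ : Γ →ₜ* Points ℚ_[ℓ] A} (hA : IsContinuousRelativeCompletion (ι.comp π) f σ)
    {A' : Type v} [CommRing A'] [HopfAlgebra ℚ_[ℓ] A'] {f' : O →ₐc[ℚ_[ℓ]] A'}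
    {σ' : E →ₜ* Points ℚ_[ℓ] A'} (hA' : IsContinuousRelativeCompletion (ι.comp q) f' σ') :
    ∃! e : A' ≃ₐc[ℚ_[ℓ]] A, (e : A' →ₐc[ℚ_[ℓ]] A).comp f' = f ∧
      (Points.map (e : A' →ₐc[ℚ_[ℓ]] A)).comp σ = σ'.comp j := by
  obtain ⟨ψ, hψj, hψ⟩ := hE.exists_extension hπ hι hA.extension σ hA.lift
  have hlift : (Points.map f').comp (σ'.comp j) =
      ι.comp π := by
    ext1 x
    refine (DFunLike.congr_fun hA'.lift (j x)).trans ?_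
    exact congrArg ι (DFunLike.congr_fun hE.lift x)
  obtain ⟨φ, ⟨hφf, hφσ⟩, hφu⟩ := hA.universal A' f' (σ'.comp j) hA'.extension hlift
  obtain ⟨θ, ⟨hθf, hθσ⟩, -⟩ := hA'.universal A f ψ hA.extension hψ
  have hφ_apply : ∀ x, Points.map φ (σ x) = σ' (j x) :=
    fun x => DFunLike.congr_fun hφσ x
  have hθ_apply : ∀ y, Points.map θ (σ' y) = ψ y :=
    fun y => DFunLike.congr_fun hθσ y
  have hψ_apply : ∀ x, ψ (j x) = σ x := fun x => DFunLike.congr_fun hψj x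
  -- Both sides solve the universal problem of `A` for its own data `(f, σ)`.
  have hφθ : φ.comp θ = BialgHom.id ℚ_[ℓ] A := by
    refine (hA.universal A f σ hA.extension hA.lift).unique ⟨?_, ?_⟩ ⟨?_, ?_⟩
    · rw [BialgHom.comp_assoc, hθf, hφf]
    · ext1 x
      change Points.map θ (Points.map φ (σ x)) = σ x
      rw [hφ_apply, hθ_apply, hψ_apply]
    · exact BialgHom.id_comp f
    · rfl
  have hθφ : θ.comp φ = BialgHom.id ℚ_[ℓ] A' := by
    refine (hA'.universal A' f' σ' hA'.extension hA'.lift).unique ⟨?_, ?_⟩ ⟨?_, ?_⟩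
    · rw [BialgHom.comp_assoc, hφf, hθf]
    -- The relations among `φ`, `θ` and `ψ` give agreement only on the image of `j`; density extends
    -- it to `E`.
    · apply DFunLike.coe_injective
      refine hE.dense.equalizer ((Points.map (θ.comp φ)).comp
        σ').continuous_toFun σ'.continuous_toFun (funext fun x => ?_)
      change Points.map φ (Points.map θ (σ' (j x))) =
        σ' (j x)
      rw [hθ_apply, hψ_apply, hφ_apply]
    · exact BialgHom.id_comp f'
    · rfl
  refine ⟨BialgEquiv.ofBialgHom φ θ hφθ hθφ, ⟨?_, ?_⟩, ?_⟩
  · rw [BialgEquiv.coe_ofBialgHom, hφf]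
  · rw [BialgEquiv.coe_ofBialgHom, hφσ]
  · rintro e ⟨hef, heσ⟩
    have he := hφu _ ⟨hef, heσ⟩
    exact BialgEquiv.ext fun a => DFunLike.congr_fun he a

/-- The values at `1 ⊗ₜ b` recover the integral point. This lets `P` be regarded as a subgroup of
`R(ℚ_ℓ)`. -/
theorem integralPoints_injective (ℓ : ℕ) [Fact ℓ.Prime] (B : Type v) [CommRing B]
    [HopfAlgebra ℤ_[ℓ] B] : Function.Injective (integralPoints ℓ B) := by
  intro p q h
  refine Points.ext_apply fun b => Subtype.val_injective ?_
  have hb : ∀ r : Points ℤ_[ℓ] B, (integralPoints ℓ B r).ofConv (1 ⊗ₜ b) = (r.ofConv b : ℚ_[ℓ]) := by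
    intro r
    change (1 : ℚ_[ℓ]) * _ = _
    rw [one_mul]
    rfl
  rw [← hb, ← hb, h]

theorem toImage_surjective {Γ : ProfiniteGrp.{u}} {H : Type w} [Group H] [TopologicalSpace H]
    [IsTopologicalGroup H] [TotallyDisconnectedSpace H] (ρ : Γ →ₜ* H) :
    Function.Surjective (toImage ρ) :=
  ρ.toMonoidHom.rangeRestrict_surjective

theorem imageInclusion_injective {Γ : ProfiniteGrp.{u}} {H : Type w} [Group H]
    [TopologicalSpace H] [IsTopologicalGroup H] [TotallyDisconnectedSpace H] (ρ : Γ →ₜ* H) :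
    Function.Injective (imageInclusion ρ) :=
  Subtype.val_injective

end RelativeCompletion

theorem mainTheorem10 (ℓ : ℕ) [Fact ℓ.Prime]
    (Γ : ProfiniteGrp.{u})
    (B : Type v) [CommRing B] [HopfAlgebra ℤ_[ℓ] B] [Algebra.FiniteType ℤ_[ℓ] B]
    (hR : RelativeCompletion.IsReductive ℚ_[ℓ] (RelativeCompletion.GenericFibre ℓ B))
    (ρ : Γ →ₜ* RelativeCompletion.Points ℤ_[ℓ] B)
    (hρ : RelativeCompletion.IsZariskiDense
      (Set.range ((RelativeCompletion.integralPoints ℓ B).comp ρ)))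
    (Γrel : ProfiniteGrp.{u}) (j : Γ →ₜ* Γrel) (q : Γrel →ₜ* RelativeCompletion.image ρ)
    (hΓrel : RelativeCompletion.IsRelativeProLCompletion ℓ (RelativeCompletion.toImage ρ) j q)
    (A : Type w) [CommRing A] [HopfAlgebra ℚ_[ℓ] A]
    (f : RelativeCompletion.GenericFibre ℓ B →ₐc[ℚ_[ℓ]] A)
    (σ : Γ →ₜ* RelativeCompletion.Points ℚ_[ℓ] A)
    (hA : RelativeCompletion.IsContinuousRelativeCompletion
      ((RelativeCompletion.integralPoints ℓ B).comp ρ) f σ)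
    (A' : Type w) [CommRing A'] [HopfAlgebra ℚ_[ℓ] A']
    (f' : RelativeCompletion.GenericFibre ℓ B →ₐc[ℚ_[ℓ]] A')
    (σ' : Γrel →ₜ* RelativeCompletion.Points ℚ_[ℓ] A')
    (hA' : RelativeCompletion.IsContinuousRelativeCompletion
      ((RelativeCompletion.integralPoints ℓ B).comp
        ((RelativeCompletion.imageInclusion ρ).comp q)) f' σ') :
    ∃! e : A' ≃ₐc[ℚ_[ℓ]] A,
      (e : A' →ₐc[ℚ_[ℓ]] A).comp f' = f ∧
      (RelativeCompletion.Points.map (e : A' →ₐc[ℚ_[ℓ]] A)).comp σ = σ'.comp j := by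
  have hinj : Function.Injective ((RelativeCompletion.integralPoints ℓ B).comp
      (RelativeCompletion.imageInclusion ρ)) :=
    (RelativeCompletion.integralPoints_injective ℓ B).comp
      (RelativeCompletion.imageInclusion_injective ρ)
  exact hΓrel.existsUnique_bialgEquiv (RelativeCompletion.toImage_surjective ρ) hinj hA hA'
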